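/- Let $n\ge 3$ and let $\mathcal M$ be a finite nonempty collection of $m$ distinct lines in $\mathbb P^n=\mathbb P^n_{\mathbb C}$ in general linear position, i.e. for every $s$ with $1\le s\le m$, any $s$ lines of $\mathcal M$ span a linear subspace $\mathbb P^r$ with $r=\min\{2s-1,n\}$. Let $S=\mathbb C[x_0,\dots,x_n]$, let $J\subset S$ be the defining ideal of $\mathcal M$ (the ideal generated by all homogeneous polynomials vanishing on every line of $\mathcal M$), and let $R=S/J$ be the homogeneous coordinate ring. Let $\operatorname{pdim}_S(R)$ be the projective dimension of $R$ as an $S$-module, $\operatorname{depth}(R)$ the largest length of an $R$-regular sequence contained in the maximal homogeneous ideal $\mathfrak m_R=(x_0,\dots,x_n)R$, and $\dim(R)$ the Krull dimension of $R$. If $m=1$, then $\operatorname{pdim}_S(R)=n-1$, $\operatorname{depth}(R)=2$ and $\dim(R)=2$. If $m\ge 2$, then $\operatorname{pdim}_S(R)=n$, $\operatorname{depth}(R)=1$ and $\dim(R)=2$. In particular, $R$ is Cohen–Macaulay (that is, $\operatorname{depth}(R)=\dim(R)$) if and only if $m=1$. -/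

import Mathlib

open scoped LinearAlgebra.Projectivization

noncomputable section

namespace LinesInProjectiveSpace

/-- Complex projective space `ℙⁿ`, the points being the one-dimensional subspaces of `ℂⁿ⁺¹`. -/
abbrev PSpace (n : ℕ) : Type := ℙ ℂ (Fin (n + 1) → ℂ)

/-- Linear (projective) subspaces of `ℙⁿ`. -/
abbrev LinSubspace (n : ℕ) : Type := Projectivization.Subspace ℂ (Fin (n + 1) → ℂ)

/-- `W` is a `ℙʳ` inside `ℙⁿ`: its affine cone is a vector space of dimension `r + 1`. -/
def IsPr {n : ℕ} (W : LinSubspace n) (r : ℕ) : Prop :=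
  Module.finrank ℂ (Projectivization.Subspace.submodule W) = r + 1

/-- A line in `ℙⁿ`. -/
def IsLine {n : ℕ} (W : LinSubspace n) : Prop := IsPr W 1

/-- The union of a collection of linear subspaces, as a set of points of `ℙⁿ`. -/
def pointSet {n : ℕ} (M : Finset (LinSubspace n)) : Set (PSpace n) :=
  ⋃ L ∈ M, (L : Set (PSpace n))

/-- A collection of lines is in general linear position if any `s ≥ 1` of them span a `ℙʳ`
with `r = min (2 s - 1) n`. -/
def InGeneralLinearPosition {n : ℕ} (M : Finset (LinSubspace n)) : Prop :=
  ∀ s : Finset (LinSubspace n), s ⊆ M → s.Nonempty →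
    IsPr (Projectivization.Subspace.span (pointSet s)) (min (2 * s.card - 1) n)

/-- The polynomial ring `S = ℂ[x₀, …, xₙ]`. -/
abbrev S (n : ℕ) : Type := MvPolynomial (Fin (n + 1)) ℂ

/-- The defining ideal of a set of points `X` of `ℙⁿ`: the ideal generated by the homogeneous
polynomials that vanish at every point of `X`. -/
def definingIdeal {n : ℕ} (X : Set (PSpace n)) : Ideal (S n) :=
  Ideal.span {f : S n | (∃ d : ℕ, f.IsHomogeneous d) ∧
    ∀ (v : Fin (n + 1) → ℂ) (hv : v ≠ 0),
      Projectivization.mk ℂ v hv ∈ X → MvPolynomial.eval v f = 0}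

/-- The homogeneous coordinate ring `R = S / J` of a collection of linear subspaces, `J` being the
defining ideal of their union. -/
abbrev CoordRing {n : ℕ} (M : Finset (LinSubspace n)) : Type :=
  S n ⧸ definingIdeal (pointSet M)

/-- The maximal homogeneous ideal `𝔪_R` of the coordinate ring, generated by the classes of
`x₀, …, xₙ`. -/
def maxHomogeneousIdeal {n : ℕ} (M : Finset (LinSubspace n)) : Ideal (CoordRing M) :=
  (MvPolynomial.idealOfVars (Fin (n + 1)) ℂ).map
    (Ideal.Quotient.mk (definingIdeal (pointSet M)))

/-- The supremum of the lengths of the `A`-regular sequences with all entries in the ideal `I`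
of `A`. -/
def depthIn {A : Type*} [CommRing A] (I : Ideal A) : ℕ∞ :=
  ⨆ rs : {rs : List A // (∀ r ∈ rs, r ∈ I) ∧ RingTheory.Sequence.IsRegular A rs},
    (rs.1.length : ℕ∞)

/-- The depth of the coordinate ring as a graded ring: the largest length of a regular sequence
in its maximal homogeneous ideal. -/
def depth {n : ℕ} (M : Finset (LinSubspace n)) : ℕ∞ := depthIn (maxHomogeneousIdeal M)

/-- The projective dimension of the coordinate ring as a module over `S`. -/
def pdim {n : ℕ} (M : Finset (LinSubspace n)) : WithBot ℕ∞ :=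
  CategoryTheory.projectiveDimension (ModuleCat.of (S n) (CoordRing M))

/-- The coordinate ring is Cohen–Macaulay: its depth equals its Krull dimension. -/
def IsCohenMacaulay {n : ℕ} (M : Finset (LinSubspace n)) : Prop :=
  (depth M : WithBot ℕ∞) = ringKrullDim (CoordRing M)

end LinesInProjectiveSpace

end

/-! The cone over a line `L` is a plane in `ℂⁿ⁺¹`, with prime ideal `P_L` generated by `n - 1`
independent linear forms. So `S/P_L` has dimension and depth 2 and projective dimension `n - 1`,
which settles a single line. In general `J` is the intersection of the `P_L`
(`definingIdeal_pointSet`), hence the dimension is 2.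

General position enters only through pairs: as `n ≥ 3`, two of the lines are disjoint, so `P_L +
P_L'` is the ideal `m` of the origin. Split off one line, `J = I ∩ P`. A prime over `I + P` contains
some `P_L' + P = m`, so `I + P` contains a power of `m`, and `S/(I + P)` has the projective
dimension `n + 1` of `S/m` (`pdLT_of_pow_le`, `not_pdLT_of_pow_le`). The Mayer–Vietoris sequence `0
→ S/J → S/I × S/P → S/(I + P) → 0` then gives projective dimension `n` for `S/J`.

Depth is found directly, without the Auslander–Buchsbaum formula: prime avoidance gives a regular
element, and a socle element of `S/(I + P)` excludes a regular pair
(`not_isWeaklyRegular_pair_inf`). -/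

namespace LinesInProjectiveSpace

open CategoryTheory Abelian

/-! ### Projective dimension and Ext in short exact sequences -/

section Homological

variable {A : Type} [CommRing A]

lemma hasProjectiveDimensionLT_of_linearEquiv {X Y : Type} [AddCommGroup X] [Module A X]
    [AddCommGroup Y] [Module A Y] (e : X ≃ₗ[A] Y) (d : ℕ)
    (h : HasProjectiveDimensionLT (ModuleCat.of A X) d) :
    HasProjectiveDimensionLT (ModuleCat.of A Y) d :=
  hasProjectiveDimensionLT_of_iso e.toModuleIso d

lemma hasProjectiveDimensionLT_of_le {X : ModuleCat.{0} A} {d e : ℕ} (hde : d ≤ e)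
    (h : HasProjectiveDimensionLT X d) : HasProjectiveDimensionLT X e :=
  hasProjectiveDimensionLT_of_ge X d e hde

variable {X Y Z : Type} [AddCommGroup X] [Module A X] [AddCommGroup Y] [Module A Y]
  [AddCommGroup Z] [Module A Z]

/-- The short complex of modules attached to an exact pair of linear maps. -/
noncomputable abbrev exactShortComplex {f : X →ₗ[A] Y} {g : Y →ₗ[A] Z}
    (h : Function.Exact f g) : ShortComplex (ModuleCat.{0} A) :=
  ModuleCat.shortComplexOfCompEqZero f g h.linearMap_comp_eq_zero

lemma shortExact_exactShortComplex {f : X →ₗ[A] Y} {g : Y →ₗ[A] Z} (h : Function.Exact f g)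
    (hf : Function.Injective f) (hg : Function.Surjective g) :
    (exactShortComplex h).ShortExact :=
  ModuleCat.shortComplex_shortExact _ h hf hg

/-- Multiplication by an element `a` annihilating `N` is zero on `Ext(-, N)`; hence if `a` is
`X`-regular, `Ext^k(X, N)` embeds into `Ext^(k+1)(X/aX, N)`. -/
lemma nontrivial_ext_succ {g : X →ₗ[A] Z} {a : A} {N : ModuleCat.{0} A}
    (h : Function.Exact (LinearMap.lsmul A X a) g)
    (hf : Function.Injective (LinearMap.lsmul A X a)) (hg : Function.Surjective g)
    (ha : a • 𝟙 N = 0) (k : ℕ) (hk : Nontrivial (Ext (ModuleCat.of A X) N k)) :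
    Nontrivial (Ext (ModuleCat.of A Z) N (k + 1)) := by
  by_contra hn
  rw [not_nontrivial_iff_subsingleton] at hn
  have hS := shortExact_exactShortComplex h hf hg
  obtain ⟨x, hx⟩ := exists_ne (0 : Ext (ModuleCat.of A X) N k)
  obtain ⟨y, hy⟩ := Ext.contravariant_sequence_exact₁ hS N x (add_comm 1 k)
    (@Subsingleton.elim _ hn _ _)
  have hfa : (exactShortComplex h).f = a • 𝟙 (ModuleCat.of A X) := rfl
  apply hx
  -- Now `x = a • y`; the scalar is moved to the second argument, where it acts as zero.
  rw [← hy, hfa, Ext.mk₀_smul, Ext.smul_comp, Ext.mk₀_id_comp]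
  change a • y = 0
  rw [← Ext.comp_mk₀_id y, ← Ext.comp_smul, ← Ext.mk₀_smul, ha, Ext.mk₀_zero, Ext.comp_zero]

end Homological

/-! ### Projective dimension of cyclic modules -/

section Quotients

variable {A : Type} [CommRing A]

/-- `A ⧸ I` has projective dimension `< d` over `A`. -/
abbrev PdLT (I : Ideal A) (d : ℕ) : Prop :=
  HasProjectiveDimensionLT (ModuleCat.of A (A ⧸ I)) d

/-- Serves two sequences: multiplication by a regular element on `A ⧸ I`, and the embedding of `A ⧸
m` into `A ⧸ Q` given by a socle element. -/
lemma exact_factor_of_apply_mk {P Q : Ideal A} (f : (A ⧸ P) →ₗ[A] (A ⧸ Q)) (b : A)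
    (hf : ∀ x : A, f (Submodule.Quotient.mk x) = Submodule.Quotient.mk (x * b)) :
    Function.Exact f (Submodule.factor (le_sup_left : Q ≤ Q ⊔ Ideal.span {b})) := by
  intro x
  obtain ⟨x, rfl⟩ := Submodule.Quotient.mk_surjective _ x
  change (Submodule.Quotient.mk x : A ⧸ (Q ⊔ Ideal.span {b})) = 0 ↔ _
  rw [Submodule.Quotient.mk_eq_zero, Submodule.mem_sup]
  constructor
  · rintro ⟨y, hy, z, hz, rfl⟩
    obtain ⟨w, rfl⟩ := Ideal.mem_span_singleton'.1 hz
    refine ⟨Submodule.Quotient.mk w, ?_⟩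
    rw [hf, Submodule.Quotient.eq]
    have : w * b - (y + w * b) = -y := by ring
    rw [this]
    exact Q.neg_mem hy
  · rintro ⟨w, hw⟩
    obtain ⟨w, rfl⟩ := Submodule.Quotient.mk_surjective _ w
    rw [hf, Submodule.Quotient.eq] at hw
    refine ⟨x - w * b, ?_, w * b, Ideal.mem_span_singleton.2 (dvd_mul_left _ _), by ring⟩
    rw [← neg_sub]
    exact Q.neg_mem hw

lemma exact_lsmul_factor (I : Ideal A) (a : A) :
    Function.Exact (LinearMap.lsmul A (A ⧸ I) a)
      (Submodule.factor (le_sup_left : I ≤ I ⊔ Ideal.span {a})) :=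
  exact_factor_of_apply_mk _ a fun x => by
    rw [LinearMap.lsmul_apply, ← Submodule.Quotient.mk_smul, smul_eq_mul, mul_comm]

lemma lsmul_injective_of_isPrime (I : Ideal A) [I.IsPrime] {a : A} (ha : a ∉ I) :
    Function.Injective (LinearMap.lsmul A (A ⧸ I) a) := by
  rw [← LinearMap.ker_eq_bot, LinearMap.ker_eq_bot']
  intro x hx
  obtain ⟨x, rfl⟩ := Submodule.Quotient.mk_surjective _ x
  rw [LinearMap.lsmul_apply, ← Submodule.Quotient.mk_smul, Submodule.Quotient.mk_eq_zero,
    smul_eq_mul] at hx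
  exact (Submodule.Quotient.mk_eq_zero _).2 ((Ideal.IsPrime.mem_or_mem ‹_› hx).resolve_left ha)

lemma pdLT_bot : PdLT (⊥ : Ideal A) 1 :=
  hasProjectiveDimensionLT_of_linearEquiv (Submodule.quotEquivOfEqBot (⊥ : Ideal A) rfl).symm 1
    (inferInstanceAs (HasProjectiveDimensionLT (ModuleCat.of A A) 1))

lemma pdLT_sup_span_singleton (I : Ideal A) [I.IsPrime] {a : A} (ha : a ∉ I) {d : ℕ}
    (h : PdLT I d) : PdLT (I ⊔ Ideal.span {a}) (d + 1) :=
  (shortExact_exactShortComplex (exact_lsmul_factor I a) (lsmul_injective_of_isPrime I ha)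
    (Submodule.factor_surjective _)).hasProjectiveDimensionLT_X₃ d h
    (hasProjectiveDimensionLT_of_le d.le_succ h)

lemma nontrivial_ext_sup_span_singleton (I m : Ideal A) [I.IsPrime] {a : A} (ha : a ∉ I)
    (ham : a ∈ m) {k : ℕ}
    (h : Nontrivial (Ext (ModuleCat.of A (A ⧸ I)) (ModuleCat.of A (A ⧸ m)) k)) :
    Nontrivial (Ext (ModuleCat.of A (A ⧸ (I ⊔ Ideal.span {a}))) (ModuleCat.of A (A ⧸ m))
      (k + 1)) := by
  refine nontrivial_ext_succ (exact_lsmul_factor I a) (lsmul_injective_of_isPrime I ha)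
    (Submodule.factor_surjective _) ?_ k h
  refine ModuleCat.hom_ext (LinearMap.ext fun x => ?_)
  obtain ⟨x, rfl⟩ := Submodule.Quotient.mk_surjective _ x
  change a • (Submodule.Quotient.mk x : A ⧸ m) = 0
  rw [← Submodule.Quotient.mk_smul, Submodule.Quotient.mk_eq_zero]
  exact m.mul_mem_right _ ham

lemma nontrivial_ext_zero {I m : Ideal A} (h : I ≤ m) (hm : m ≠ ⊤) :
    Nontrivial (Ext (ModuleCat.of A (A ⧸ I)) (ModuleCat.of A (A ⧸ m)) 0) := by
  refine ⟨Ext.mk₀ (ModuleCat.ofHom (Submodule.factor h)), 0, fun h0 => hm ?_⟩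
  rw [Ext.mk₀_eq_zero_iff] at h0
  have h1 := congrArg (fun f => f.hom (Submodule.Quotient.mk (1 : A))) h0
  exact (Ideal.eq_top_iff_one m).2 ((Submodule.Quotient.mk_eq_zero m).1 h1)

lemma not_pdLT_of_nontrivial_ext {I : Ideal A} {N : ModuleCat.{0} A} {k : ℕ}
    (h : Nontrivial (Ext (ModuleCat.of A (A ⧸ I)) N k)) : ¬ PdLT I k := fun _ =>
  not_subsingleton _ (HasProjectiveDimensionLT.subsingleton (ModuleCat.of A (A ⧸ I)) k k le_rfl N)

/-- A finitely generated module killed by a power of the maximal ideal `m` is a successive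
extension of copies of `A ⧸ m`. -/
lemma hasProjectiveDimensionLT_of_pow_annihilates [IsNoetherianRing A] {m : Ideal A}
    (hm : m.IsMaximal) {d : ℕ} (h : PdLT m d) (M : Type) [AddCommGroup M] [Module A M]
    [Module.Finite A M] (k : ℕ) (hk : ∀ a ∈ m ^ k, ∀ x : M, a • x = 0) :
    HasProjectiveDimensionLT (ModuleCat.of A M) d := by
  revert hk
  induction ‹Module.Finite A M› using IsNoetherianRing.induction_on_isQuotientEquivQuotientPrime with
  | subsingleton N =>
    intro _
    exact hasProjectiveDimensionLT_of_le d.zero_le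
      (ModuleCat.isZero_of_subsingleton (ModuleCat.of A N)).hasProjectiveDimensionLT_zero
  | quotient N p e =>
    intro hk
    -- Only the prime `m` can occur as a factor: the annihilator `p` of `N` contains `m ^ k`.
    have hp : m ^ k ≤ p.1 := by
      intro a ha
      have := hk a ha (e.symm (Submodule.Quotient.mk 1))
      rw [← map_smul, LinearEquiv.map_eq_zero_iff, ← Submodule.Quotient.mk_smul,
        Submodule.Quotient.mk_eq_zero] at this
      simpa using this
    have hmp : m = p.1 := hm.eq_of_le p.2.ne_top (p.2.le_of_pow_le hp)
    exact hasProjectiveDimensionLT_of_linearEquiv e.symm d (hmp ▸ h)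
  | exact N₁ N₂ N₃ f g hf hg hfg h₁ h₃ =>
    intro hk
    refine (shortExact_exactShortComplex hfg hf hg).hasProjectiveDimensionLT_X₂ d
      (h₁ fun a ha x => hf ?_) (h₃ fun a ha x => ?_)
    · rw [map_smul, hk a ha, map_zero]
    · obtain ⟨y, rfl⟩ := hg x
      rw [← map_smul, hk a ha, map_zero]

lemma pdLT_of_pow_le [IsNoetherianRing A] {m : Ideal A} (hm : m.IsMaximal) {d : ℕ}
    (h : PdLT m d) {Q : Ideal A} {k : ℕ} (hQ : m ^ k ≤ Q) : PdLT Q d := by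
  refine hasProjectiveDimensionLT_of_pow_annihilates hm h (A ⧸ Q) k fun a ha x => ?_
  obtain ⟨x, rfl⟩ := Submodule.Quotient.mk_surjective _ x
  rw [← Submodule.Quotient.mk_smul, Submodule.Quotient.mk_eq_zero]
  exact Q.mul_mem_right _ (hQ ha)

/-- A proper ideal containing a power of `m` has a socle element. -/
lemma exists_socle {m Q : Ideal A} {k : ℕ} (hQ : m ^ k ≤ Q) (hQ' : Q ≠ ⊤) :
    ∃ b ∉ Q, ∀ a ∈ m, a * b ∈ Q := by
  induction k with
  | zero => exact absurd (top_le_iff.1 (by simpa using hQ)) hQ'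
  | succ k ih =>
    by_cases h : m ^ k ≤ Q
    · exact ih h
    · obtain ⟨b, hb, hbQ⟩ := SetLike.not_le_iff_exists.1 h
      exact ⟨b, hbQ, fun a ha => hQ (by rw [pow_succ']; exact Ideal.mul_mem_mul ha hb)⟩

/-- A socle element `b` embeds `A ⧸ m` in `A ⧸ Q`. The cokernel is again killed by `m ^ k`, so its
projective dimension is at most `d`; if that of `A ⧸ Q` were below `d`, so would be that of `A ⧸ m`.
-/
lemma not_pdLT_of_pow_le [IsNoetherianRing A] {m : Ideal A} (hm : m.IsMaximal) {d : ℕ}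
    (h : PdLT m (d + 1)) (h' : ¬ PdLT m d) {Q : Ideal A} {k : ℕ} (hQ : m ^ k ≤ Q)
    (hQ' : Q ≠ ⊤) : ¬ PdLT Q d := by
  intro hd
  obtain ⟨b, hb, hbm⟩ := exists_socle hQ hQ'
  let f : (A ⧸ m) →ₗ[A] (A ⧸ Q) := Submodule.mapQ m Q (LinearMap.mulRight A b) hbm
  have hf : ∀ x : A, f (Submodule.Quotient.mk x) = Submodule.Quotient.mk (x * b) := fun _ => rfl
  have hfinj : Function.Injective f := by
    rw [← LinearMap.ker_eq_bot, LinearMap.ker_eq_bot']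
    intro x hx
    obtain ⟨x, rfl⟩ := Submodule.Quotient.mk_surjective _ x
    rw [hf, Submodule.Quotient.mk_eq_zero] at hx
    rw [Submodule.Quotient.mk_eq_zero]
    -- Outside `m`, `x` is invertible modulo `m`, so `x * b ∈ Q` would give `b ∈ Q`.
    by_contra hxm
    obtain ⟨y, i, hi, hy⟩ := hm.exists_inv hxm
    apply hb
    have : b = y * (x * b) + i * b := by linear_combination -b * hy
    rw [this]
    exact Q.add_mem (Q.mul_mem_left _ hx) (hbm i hi)
  exact h' ((shortExact_exactShortComplex (exact_factor_of_apply_mk f b hf) hfinj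
    (Submodule.factor_surjective _)).hasProjectiveDimensionLT_X₁ d hd
    (pdLT_of_pow_le hm h (hQ.trans le_sup_left)))

/-- `0 → A/(I ∩ J) → A/I × A/J → A/(I + J) → 0` is exact. -/
lemma exists_mayerVietoris (I J : Ideal A) :
    ∃ (f : (A ⧸ (I ⊓ J)) →ₗ[A] (A ⧸ I) × (A ⧸ J)) (g : (A ⧸ I) × (A ⧸ J) →ₗ[A] (A ⧸ (I ⊔ J))),
      Function.Exact f g ∧ Function.Injective f ∧ Function.Surjective g := by
  refine ⟨(Submodule.factor inf_le_left).prod (Submodule.factor inf_le_right),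
    (Submodule.factor le_sup_left).comp (LinearMap.fst A _ _) -
      (Submodule.factor le_sup_right).comp (LinearMap.snd A _ _), ?_, ?_, ?_⟩
  · rintro ⟨x, y⟩
    obtain ⟨x, rfl⟩ := Submodule.Quotient.mk_surjective _ x
    obtain ⟨y, rfl⟩ := Submodule.Quotient.mk_surjective _ y
    change (Submodule.Quotient.mk x : A ⧸ (I ⊔ J)) - Submodule.Quotient.mk y = 0 ↔ _
    rw [sub_eq_zero, Submodule.Quotient.eq, Submodule.mem_sup]
    constructor
    · rintro ⟨u, hu, v, hv, huv⟩
      refine ⟨Submodule.Quotient.mk (x - u), Prod.ext ?_ ?_⟩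
      · refine (Submodule.Quotient.eq I).2 ?_
        change x - u - x ∈ I
        have : x - u - x = -u := by ring
        rw [this]
        exact I.neg_mem hu
      · refine (Submodule.Quotient.eq J).2 ?_
        change x - u - y ∈ J
        have : x - u - y = v := by linear_combination -huv
        rwa [this]
    · rintro ⟨w, hw⟩
      obtain ⟨w, rfl⟩ := Submodule.Quotient.mk_surjective _ w
      have h1 := (Submodule.Quotient.eq I).1 (congrArg Prod.fst hw)
      have h2 := (Submodule.Quotient.eq J).1 (congrArg Prod.snd hw)
      exact ⟨-(w - x), I.neg_mem h1, w - y, h2, by ring⟩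
  · rw [← LinearMap.ker_eq_bot, LinearMap.ker_eq_bot']
    intro x hx
    obtain ⟨x, rfl⟩ := Submodule.Quotient.mk_surjective _ x
    rw [Submodule.Quotient.mk_eq_zero]
    exact ⟨(Submodule.Quotient.mk_eq_zero I).1 (congrArg Prod.fst hx),
      (Submodule.Quotient.mk_eq_zero J).1 (congrArg Prod.snd hx)⟩
  · intro x
    obtain ⟨x, rfl⟩ := Submodule.Quotient.mk_surjective _ x
    exact ⟨(Submodule.Quotient.mk x, 0), by simp⟩

lemma hasProjectiveDimensionLT_prod {X Y : Type} [AddCommGroup X] [Module A X] [AddCommGroup Y]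
    [Module A Y] {d : ℕ} (hX : HasProjectiveDimensionLT (ModuleCat.of A X) d)
    (hY : HasProjectiveDimensionLT (ModuleCat.of A Y) d) :
    HasProjectiveDimensionLT (ModuleCat.of A (X × Y)) d :=
  (shortExact_exactShortComplex (Function.Exact.inl_snd (R := A) (M := X) (N := Y))
    LinearMap.inl_injective LinearMap.snd_surjective).hasProjectiveDimensionLT_X₂ d hX hY

lemma pdLT_inf {I J : Ideal A} {d : ℕ} (hI : PdLT I d) (hJ : PdLT J d)
    (hIJ : PdLT (I ⊔ J) (d + 1)) : PdLT (I ⊓ J) d := by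
  obtain ⟨f, g, h, hf, hg⟩ := exists_mayerVietoris I J
  exact (shortExact_exactShortComplex h hf hg).hasProjectiveDimensionLT_X₁ d
    (hasProjectiveDimensionLT_prod hI hJ) hIJ

lemma not_pdLT_inf {I J : Ideal A} {d : ℕ} (hI : PdLT I (d + 1)) (hJ : PdLT J (d + 1))
    (hIJ : ¬ PdLT (I ⊔ J) (d + 1)) : ¬ PdLT (I ⊓ J) d := by
  obtain ⟨f, g, h, hf, hg⟩ := exists_mayerVietoris I J
  exact fun hd => hIJ ((shortExact_exactShortComplex h hf hg).hasProjectiveDimensionLT_X₃ d hd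
    (hasProjectiveDimensionLT_prod hI hJ))

end Quotients

end LinesInProjectiveSpace

namespace LinesInProjectiveSpace

open CategoryTheory RingTheory.Sequence

/-! ### Finite intersections of primes with pairwise sums containing `m` -/

section PrimeFamily

variable {A : Type} [CommRing A] {ι : Type*} {m : Ideal A} {s : Finset ι} {p : ι → Ideal A}

/-- A prime over the right-hand side contains some `p i`, hence `p i ⊔ q` and `m`; so `m` lies in
the radical. -/
lemma exists_pow_le_inf_sup [IsNoetherianRing A] {q : Ideal A} (h : ∀ i ∈ s, m ≤ p i ⊔ q) :
    ∃ k, m ^ k ≤ s.inf p ⊔ q := by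
  refine Ideal.exists_pow_le_of_le_radical_of_fg ?_ (IsNoetherian.noetherian m)
  rw [Ideal.radical_eq_sInf]
  refine le_sInf ?_
  rintro P ⟨hP, hPp⟩
  obtain ⟨i, hi, hiP⟩ := (Ideal.IsPrime.inf_le' hPp).1 (le_sup_left.trans hP)
  exact (h i hi).trans (sup_le hiP (le_sup_right.trans hP))

lemma inf_sup_ne_top (hm : m.IsMaximal) (hs : s.Nonempty) (hp : ∀ i ∈ s, p i ≤ m) {q : Ideal A}
    (hq : q ≤ m) : s.inf p ⊔ q ≠ ⊤ := by
  obtain ⟨i, hi⟩ := hs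
  exact fun h => hm.ne_top (top_le_iff.1 (h ▸ sup_le ((Finset.inf_le hi).trans (hp i hi)) hq))

/-- Ideals are added one at a time by Mayer–Vietoris; each sum contains a power of `m`, so its bound
comes from `A ⧸ m`. -/
lemma pdLT_finset_inf [IsNoetherianRing A] (hm : m.IsMaximal) {d : ℕ} (hmd : PdLT m (d + 1))
    (hs : s.Nonempty) (hpd : ∀ i ∈ s, PdLT (p i) d)
    (hsup : ∀ i ∈ s, ∀ j ∈ s, i ≠ j → m ≤ p i ⊔ p j) : PdLT (s.inf p) d := by
  classical
  induction hs using Finset.Nonempty.cons_induction with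
  | singleton i => simpa using hpd i (by simp)
  | cons i t hi ht ih =>
    rw [Finset.inf_cons, inf_comm]
    have hit : ∀ j ∈ t, m ≤ p j ⊔ p i := fun j hj => hsup j (by simp [hj]) i (by simp)
      (by rintro rfl; exact hi hj)
    obtain ⟨k, hk⟩ := exists_pow_le_inf_sup hit
    exact pdLT_inf (ih (fun j hj => hpd j (by simp [hj]))
      (fun j hj l hl => hsup j (by simp [hj]) l (by simp [hl])))
      (hpd i (by simp)) (pdLT_of_pow_le hm hmd hk)

lemma exists_eq_cons_of_two_le_card (hs : 2 ≤ s.card) :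
    ∃ (i : ι) (t : Finset ι) (hi : i ∉ t), t.Nonempty ∧ s = Finset.cons i t hi := by
  classical
  obtain ⟨i, hi⟩ := Finset.card_pos.1 (by omega : 0 < s.card)
  refine ⟨i, s.erase i, Finset.notMem_erase i s, ?_, ?_⟩
  · rw [← Finset.card_pos, Finset.card_erase_of_mem hi]
    omega
  · rw [Finset.cons_eq_insert, Finset.insert_erase hi]

lemma not_pdLT_finset_inf [IsNoetherianRing A] (hm : m.IsMaximal) {d : ℕ}
    (hmd : PdLT m (d + 2)) (hmd' : ¬ PdLT m (d + 1))
    (hs : 2 ≤ s.card) (hp : ∀ i ∈ s, p i ≤ m) (hpd : ∀ i ∈ s, PdLT (p i) (d + 1))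
    (hsup : ∀ i ∈ s, ∀ j ∈ s, i ≠ j → m ≤ p i ⊔ p j) : ¬ PdLT (s.inf p) d := by
  obtain ⟨i, t, hi, ht, rfl⟩ := exists_eq_cons_of_two_le_card hs
  rw [Finset.inf_cons, inf_comm]
  have hit : ∀ j ∈ t, m ≤ p j ⊔ p i := fun j hj => hsup j (by simp [hj]) i (by simp)
    (by rintro rfl; exact hi hj)
  obtain ⟨k, hk⟩ := exists_pow_le_inf_sup hit
  refine not_pdLT_inf (pdLT_finset_inf hm hmd ht (fun j hj => hpd j (by simp [hj]))
    (fun j hj l hl => hsup j (by simp [hj]) l (by simp [hl]))) (hpd i (by simp))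
    (not_pdLT_of_pow_le hm hmd hmd' hk ?_)
  exact inf_sup_ne_top hm ht (fun j hj => hp j (by simp [hj])) (hp i (by simp))

/-- The smallest prime of a chain over the intersection contains some `p i`, so the whole chain lies
over `p i`. -/
lemma ringKrullDim_quotient_finset_inf (hs : s.Nonempty) {d : WithBot ℕ∞}
    (hd : ∀ i ∈ s, ringKrullDim (A ⧸ p i) = d) : ringKrullDim (A ⧸ s.inf p) = d := by
  apply le_antisymm
  · rw [ringKrullDim_quotient]
    refine iSup_le fun l => ?_
    have hl : s.inf p ≤ l.head.1.asIdeal := l.head.2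
    obtain ⟨i, hi, hil⟩ := (Ideal.IsPrime.inf_le' l.head.1.2).1 hl
    rw [← hd i hi, ringKrullDim_quotient]
    let l' : LTSeries (PrimeSpectrum.zeroLocus (R := A) (p i)) :=
      { length := l.length
        toFun := fun k => ⟨(l k).1, hil.trans (l.head_le k)⟩
        step := l.step }
    exact le_iSup (fun l : LTSeries (PrimeSpectrum.zeroLocus (R := A) (p i)) =>
      ((l.length : ℕ∞) : WithBot ℕ∞)) l'
  · obtain ⟨i, hi⟩ := hs
    rw [← hd i hi]
    exact ringKrullDim_le_of_surjective (Ideal.Quotient.factor (Finset.inf_le hi))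
      (Ideal.Quotient.factor_surjective _)

lemma mul_mem_finset_inf_iff (hp : ∀ i ∈ s, (p i).IsPrime) {a x : A} (ha : ∀ i ∈ s, a ∉ p i) :
    a * x ∈ s.inf p ↔ x ∈ s.inf p := by
  simp only [Submodule.mem_finsetInf]
  exact forall₂_congr fun i hi =>
    ⟨fun h => ((hp i hi).mem_or_mem h).resolve_left (ha i hi), (p i).mul_mem_left a⟩

/-- A zero divisor modulo an irredundant intersection of primes lies in one of them. -/
lemma notMem_of_forall_mul_mem_inf (hp : ∀ i ∈ s, (p i).IsPrime)
    (hne : ∀ i ∈ s, ∀ j ∈ s, p i ≤ p j → i = j) {a : A}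
    (ha : ∀ x, a * x ∈ s.inf p → x ∈ s.inf p) (i : ι) (hi : i ∈ s) : a ∉ p i := by
  classical
  intro hai
  have h : ¬ (s.erase i).inf p ≤ p i := by
    rw [Ideal.IsPrime.inf_le' (hp i hi)]
    rintro ⟨j, hj, hji⟩
    exact (Finset.ne_of_mem_erase hj) (hne j (Finset.mem_of_mem_erase hj) i hi hji)
  obtain ⟨x, hx, hxi⟩ := SetLike.not_le_iff_exists.1 h
  refine hxi ((Finset.inf_le hi : s.inf p ≤ p i) (ha x ?_))
  rw [← Finset.insert_erase hi, Finset.inf_insert]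
  exact ⟨(p i).mul_mem_right x hai, ((s.erase i).inf p).mul_mem_left a hx⟩

lemma exists_mem_forall_notMem (hp : ∀ i ∈ s, (p i).IsPrime) {I : Ideal A}
    (hI : ∀ i ∈ s, ¬ I ≤ p i) : ∃ a ∈ I, ∀ i ∈ s, a ∉ p i := by
  rcases s.eq_empty_or_nonempty with rfl | ⟨i₀, -⟩
  · exact ⟨0, I.zero_mem, by simp⟩
  by_contra! h
  -- Prime avoidance tolerates two exceptional indices; all ideals here are prime, so `i₀` is
  -- arbitrary.
  obtain ⟨i, hi, hle⟩ := (Ideal.subset_union_prime i₀ i₀ (fun i hi _ _ => hp i hi)).1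
    (fun a ha => by
      obtain ⟨i, hi, hai⟩ := h a ha
      exact Set.mem_biUnion (Finset.mem_coe.2 hi) hai : (I : Set A) ⊆ ⋃ i ∈ (s : Set ι), p i)
  exact hI i hi hle

end PrimeFamily

/-! ### Regular sequences and depth -/

section RegularSequences

variable {R : Type*} [CommRing R]

lemma isSMulRegular_quotSMulTop_iff {a b : R} :
    IsSMulRegular (QuotSMulTop a R) b ↔ ∀ y, a ∣ b * y → a ∣ y := by
  have h : ∀ y : R, (Submodule.Quotient.mk y : QuotSMulTop a R) = 0 ↔ a ∣ y := by
    intro y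
    rw [Submodule.Quotient.mk_eq_zero, Submodule.mem_smul_pointwise_iff_exists]
    simp [dvd_def, eq_comm]
  rw [isSMulRegular_iff_right_eq_zero_of_smul]
  constructor
  · intro H y hy
    rw [← h]
    apply H
    rwa [← Submodule.Quotient.mk_smul, h]
  · intro H y hy
    obtain ⟨y, rfl⟩ := Submodule.Quotient.mk_surjective _ y
    rw [← Submodule.Quotient.mk_smul, h] at hy
    exact (h y).2 (H y hy)

lemma isWeaklyRegular_pair_iff {a b : R} :
    IsWeaklyRegular R [a, b] ↔ (∀ y, a * y = 0 → y = 0) ∧ ∀ y, a ∣ b * y → a ∣ y := by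
  simp only [isWeaklyRegular_cons_iff, IsWeaklyRegular.nil, and_true,
    isSMulRegular_quotSMulTop_iff]
  rw [isSMulRegular_iff_right_eq_zero_of_smul]
  rfl

lemma isRegular_of_isWeaklyRegular {rs : List R} {I : Ideal R} (hI : I ≠ ⊤)
    (h : IsWeaklyRegular R rs) (hrs : ∀ r ∈ rs, r ∈ I) : IsRegular R rs := by
  refine ⟨h, fun h' => hI (top_le_iff.1 ?_)⟩
  rw [h', smul_eq_mul, Ideal.mul_top]
  exact Ideal.span_le.2 hrs

/-- A regular element avoids the minimal primes of the support, so each quotient lowers its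
dimension by at least one. -/
lemma length_le_supportDim [IsNoetherianRing R] (rs : List R) (M : Type*) [AddCommGroup M]
    [Module R M] [Module.Finite R M] (h : IsRegular M rs) :
    ((rs.length : ℕ∞) : WithBot ℕ∞) ≤ Module.supportDim R M := by
  induction rs generalizing M with
  | nil =>
    have := h.nontrivial
    have : Module.supportDim R M ≠ ⊥ := by
      rw [Ne, Module.supportDim_eq_bot_iff_subsingleton, not_subsingleton_iff_nontrivial]
      exact this
    obtain ⟨d, hd⟩ := WithBot.ne_bot_iff_exists.1 this
    rw [← hd]
    exact WithBot.coe_le_coe.2 (by simp)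
  | cons r rs ih =>
    rw [isRegular_cons_iff] at h
    refine le_trans ?_ (Module.supportDim_quotSMulTop_succ_le_of_notMem_minimalPrimes
      (fun p hp => h.1.notMem_of_mem_minimalPrimes hp))
    have := ih _ h.2
    calc (((r :: rs).length : ℕ∞) : WithBot ℕ∞) = ((rs.length : ℕ∞) : WithBot ℕ∞) + 1 := by
          push_cast [List.length_cons]; rfl
      _ ≤ _ := by gcongr

lemma length_le_depthIn {I : Ideal R} {rs : List R} (hI : I ≠ ⊤) (h : IsWeaklyRegular R rs)
    (hrs : ∀ r ∈ rs, r ∈ I) : (rs.length : ℕ∞) ≤ depthIn I :=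
  le_iSup (fun rs : {rs : List R // (∀ r ∈ rs, r ∈ I) ∧ IsRegular R rs} => (rs.1.length : ℕ∞))
    ⟨rs, hrs, isRegular_of_isWeaklyRegular hI h hrs⟩

lemma depthIn_le_one {I : Ideal R} (h : ∀ a ∈ I, ∀ b ∈ I, ¬ IsWeaklyRegular R [a, b]) :
    depthIn I ≤ 1 := by
  refine iSup_le ?_
  rintro ⟨rs, hrs, hreg⟩
  match rs with
  | [] => simp
  | [_] => simp
  | a :: b :: t =>
    refine absurd ?_ (h a (hrs a (by simp)) b (hrs b (by simp)))
    have := hreg.1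
    simp only [isWeaklyRegular_cons_iff] at this ⊢
    exact ⟨this.1, this.2.1, IsWeaklyRegular.nil _ _⟩

lemma depthIn_le_ringKrullDim [IsNoetherianRing R] [Nontrivial R] (I : Ideal R) :
    (depthIn I : WithBot ℕ∞) ≤ ringKrullDim R := by
  obtain ⟨d, hd⟩ := WithBot.ne_bot_iff_exists.1
    (ne_bot_of_le_ne_bot WithBot.zero_ne_bot (ringKrullDim_nonneg_of_nontrivial (R := R)))
  rw [← hd, WithBot.coe_le_coe]
  refine iSup_le ?_
  rintro ⟨rs, -, hreg⟩
  rw [← WithBot.coe_le_coe, hd, ← Module.supportDim_self_eq_ringKrullDim]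
  exact length_le_supportDim rs R hreg

end RegularSequences

/-- A socle element `c` of `A ⧸ (I ⊔ J)` obstructs regular sequences of length two on
`A ⧸ (I ⊓ J)`. -/
lemma not_isWeaklyRegular_pair_inf {A : Type*} [CommRing A] {I J : Ideal A} {a b c : A}
    (haI : ∀ x, a * x ∈ I → x ∈ I) (haJ : ∀ x, a * x ∈ J → x ∈ J)
    (hc : c ∉ I ⊔ J) (hac : a * c ∈ I ⊔ J) (hbc : b * c ∈ I ⊔ J) :
    ¬ IsWeaklyRegular (A ⧸ (I ⊓ J))
      [Ideal.Quotient.mk (I ⊓ J) a, Ideal.Quotient.mk (I ⊓ J) b] := by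
  rw [isWeaklyRegular_pair_iff]
  rintro ⟨-, h⟩
  obtain ⟨i, hi, j, hj, hij⟩ := Submodule.mem_sup.1 hac
  obtain ⟨i', hi', j', hj', hij'⟩ := Submodule.mem_sup.1 hbc
  -- With `a c = i + j` and `b c = i' + j'`, this makes `b j` a multiple of `a` modulo `I ⊓ J`.
  -- Regularity would give `j = a w` there, whence `c - w ∈ I` and `w ∈ J`.
  have key : b * j - a * j' ∈ I ⊓ J := by
    refine ⟨?_, J.sub_mem (J.mul_mem_left _ hj) (J.mul_mem_left _ hj')⟩
    have : b * j - a * j' = a * i' - b * i := by linear_combination b * hij - a * hij'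
    rw [this]
    exact I.sub_mem (I.mul_mem_left _ hi') (I.mul_mem_left _ hi)
  obtain ⟨w, hw⟩ := h (Ideal.Quotient.mk _ j) ⟨Ideal.Quotient.mk _ j', by
    rw [← map_mul, ← map_mul, Ideal.Quotient.eq]
    exact key⟩
  obtain ⟨w, rfl⟩ := Ideal.Quotient.mk_surjective w
  rw [← map_mul, Ideal.Quotient.eq] at hw
  refine hc (Submodule.mem_sup.2 ⟨c - w, haI _ ?_, w, haJ _ ?_, by ring⟩)
  · have : a * (c - w) = i + (j - a * w) := by linear_combination -hij
    rw [this]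
    exact I.add_mem hi hw.1
  · have : a * w = j - (j - a * w) := by ring
    rw [this]
    exact J.sub_mem hj hw.2

lemma depthIn_quotient_finset_inf_le_one {A : Type} [CommRing A] [IsNoetherianRing A] {ι : Type*}
    {m : Ideal A} {s : Finset ι} {p : ι → Ideal A} (hm : m.IsMaximal) (hs : 2 ≤ s.card)
    (hp : ∀ i ∈ s, (p i).IsPrime) (hlt : ∀ i ∈ s, p i < m)
    (hsup : ∀ i ∈ s, ∀ j ∈ s, i ≠ j → m ≤ p i ⊔ p j) {I : Ideal A} (hI : I ≤ m) :
    depthIn (I.map (Ideal.Quotient.mk (s.inf p))) ≤ 1 := by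
  refine depthIn_le_one fun a ha b hb hab => ?_
  obtain ⟨a, haI, rfl⟩ :=
    (Ideal.mem_map_iff_of_surjective _ Ideal.Quotient.mk_surjective).1 ha
  obtain ⟨b, hbI, rfl⟩ :=
    (Ideal.mem_map_iff_of_surjective _ Ideal.Quotient.mk_surjective).1 hb
  have hreg : ∀ x, a * x ∈ s.inf p → x ∈ s.inf p := by
    intro x hx
    have := (isWeaklyRegular_pair_iff.1 hab).1 (Ideal.Quotient.mk _ x)
    rw [← map_mul, Ideal.Quotient.eq_zero_iff_mem, Ideal.Quotient.eq_zero_iff_mem] at this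
    exact this hx
  have hne : ∀ i ∈ s, ∀ j ∈ s, p i ≤ p j → i = j := fun i hi j hj hij => by
    by_contra h
    exact (hlt j hj).not_ge ((hsup i hi j hj h).trans (sup_le hij le_rfl))
  -- So `a` stays regular modulo both pieces of the splitting, as the socle argument needs.
  have hap := notMem_of_forall_mul_mem_inf hp hne hreg
  obtain ⟨i, t, hi, ht, rfl⟩ := exists_eq_cons_of_two_le_card hs
  obtain ⟨k, hk⟩ := exists_pow_le_inf_sup (s := t) (q := p i) (fun j hj =>
    hsup j (by simp [hj]) i (by simp) (by rintro rfl; exact hi hj))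
  obtain ⟨c, hc, hcm⟩ := exists_socle hk
    (inf_sup_ne_top hm ht (fun j hj => (hlt j (by simp [hj])).le) (hlt i (by simp)).le)
  rw [sup_comm] at hc hcm
  rw [Finset.inf_cons] at hab
  refine not_isWeaklyRegular_pair_inf (fun x hx => ?_) (fun x hx => ?_) hc (hcm a (hI haI))
    (hcm b (hI hbI)) hab
  · exact ((hp i (by simp)).mem_or_mem hx).resolve_left (hap i (by simp))
  · exact (mul_mem_finset_inf_iff (fun j hj => hp j (by simp [hj]))
      (fun j hj => hap j (by simp [hj]))).1 hx

end LinesInProjectiveSpace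

namespace LinesInProjectiveSpace

open CategoryTheory RingTheory.Sequence MvPolynomial

/-! ### Ideals of linear subspaces -/

section LinearForms

variable {K : Type} [Field K] {σ : Type}

lemma sub_aeval_mem {τ : Type*} {g : τ → MvPolynomial τ K} {I : Ideal (MvPolynomial τ K)}
    (h : ∀ i, X i - g i ∈ I) (q : MvPolynomial τ K) : q - aeval g q ∈ I := by
  have : (Ideal.Quotient.mkₐ K I) = (Ideal.Quotient.mkₐ K I).comp (aeval g) := by
    ext i
    simpa [Ideal.Quotient.eq] using h i
  exact Ideal.Quotient.eq.1 (DFunLike.congr_fun this q)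

/-- The ideal of polynomials vanishing on a linear subspace. -/
noncomputable abbrev linIdeal (W : Submodule K (σ → K)) : Ideal (MvPolynomial σ K) :=
  vanishingIdeal K (W : Set (σ → K))

lemma mem_linIdeal {W : Submodule K (σ → K)} {q : MvPolynomial σ K} :
    q ∈ linIdeal W ↔ ∀ v ∈ W, eval v q = 0 := by
  simp [linIdeal, aeval_eq_eval]

lemma linIdeal_anti {W W' : Submodule K (σ → K)} (h : W ≤ W') : linIdeal W' ≤ linIdeal W :=
  vanishingIdeal_anti_mono h

lemma idealOfVars_le_linIdeal_bot : idealOfVars σ K ≤ linIdeal (⊥ : Submodule K (σ → K)) := by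
  rw [Ideal.span_le]
  rintro _ ⟨i, rfl⟩
  simp

lemma linIdeal_bot_isMaximal : (linIdeal (⊥ : Submodule K (σ → K))).IsMaximal :=
  inferInstanceAs (vanishingIdeal K {(0 : σ → K)}).IsMaximal

lemma map_idealOfVars_ne_top {I : Ideal (MvPolynomial σ K)}
    (hI : I ≤ linIdeal (⊥ : Submodule K (σ → K))) :
    (idealOfVars σ K).map (Ideal.Quotient.mk I) ≠ ⊤ := by
  intro h
  have h1 : (1 : MvPolynomial σ K ⧸ I) ∈ (idealOfVars σ K).map (Ideal.Quotient.mk I) :=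
    h ▸ Submodule.mem_top
  obtain ⟨x, hx, hx1⟩ := (Ideal.mem_map_iff_of_surjective _ Ideal.Quotient.mk_surjective).1 h1
  rw [← map_one (Ideal.Quotient.mk I), Ideal.Quotient.eq] at hx1
  refine (linIdeal_bot_isMaximal (K := K) (σ := σ)).ne_top ((Ideal.eq_top_iff_one _).2 ?_)
  have : (1 : MvPolynomial σ K) = x - (x - 1) := by ring
  rw [this]
  exact Ideal.sub_mem _ (idealOfVars_le_linIdeal_bot hx) (hI hx1)

variable [Fintype σ] [DecidableEq σ]

/-- The linear form attached to a functional on `K^σ`. -/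
noncomputable def linForm (l : Module.Dual K (σ → K)) : MvPolynomial σ K :=
  ∑ i, C (l (Pi.single i 1)) * X i

@[simp]
lemma eval_linForm (l : Module.Dual K (σ → K)) (v : σ → K) : eval v (linForm l) = l v := by
  simp only [linForm, map_sum, map_mul, eval_C, eval_X]
  conv_rhs => rw [pi_eq_sum_univ' v, map_sum]
  exact Finset.sum_congr rfl fun i _ => by rw [map_smul, smul_eq_mul, mul_comm]

lemma linForm_mem_idealOfVars (l : Module.Dual K (σ → K)) : linForm l ∈ idealOfVars σ K :=
  Ideal.sum_mem _ fun i _ => Ideal.mul_mem_left _ _ (Ideal.subset_span ⟨i, rfl⟩)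

/-- Precomposition of polynomials with a linear endomorphism of `K^σ`. -/
noncomputable def pullback (f : (σ → K) →ₗ[K] (σ → K)) : MvPolynomial σ K →ₐ[K] MvPolynomial σ K :=
  aeval fun i => linForm (LinearMap.proj i ∘ₗ f)

@[simp]
lemma eval_pullback (f : (σ → K) →ₗ[K] (σ → K)) (v : σ → K) (q : MvPolynomial σ K) :
    eval v (pullback f q) = eval (f v) q := by
  have : (aeval v).comp (pullback f) = (aeval (f v) : MvPolynomial σ K →ₐ[K] K) := by
    ext i
    simp [pullback, aeval_eq_eval]
  simpa [aeval_eq_eval] using DFunLike.congr_fun this q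

lemma mk_linForm_mem_map (I : Ideal (MvPolynomial σ K)) (l : Module.Dual K (σ → K)) :
    Ideal.Quotient.mk I (linForm l) ∈ (idealOfVars σ K).map (Ideal.Quotient.mk I) :=
  Ideal.mem_map_of_mem _ (linForm_mem_idealOfVars l)

/-- `W' = W ∩ ker l` is a hyperplane of the subspace `W`, cut out by the functional `l`. -/
structure IsHyperplaneOf (W' W : Submodule K (σ → K)) (l : Module.Dual K (σ → K)) : Prop where
  eq_inf : W' = W ⊓ LinearMap.ker l
  exists_apply_ne_zero : ∃ w ∈ W, l w ≠ 0

omit [Fintype σ] [DecidableEq σ] in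
lemma exists_isHyperplaneOf_left {W : Submodule K (σ → K)} (hW : W ≠ ⊥) :
    ∃ W' l, IsHyperplaneOf W' W l := by
  obtain ⟨w, hw, hw0⟩ := W.exists_mem_ne_zero_of_ne_bot hW
  obtain ⟨l, hl, -⟩ := Submodule.exists_le_ker_of_notMem (K := K) (p := ⊥) (by simpa using hw0)
  exact ⟨_, l, rfl, w, hw, hl⟩

omit [Fintype σ] [DecidableEq σ] in
lemma exists_isHyperplaneOf_right {W' : Submodule K (σ → K)} (hW : W' ≠ ⊤) :
    ∃ W l, IsHyperplaneOf W' W l := by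
  obtain ⟨w, -, hw⟩ := SetLike.exists_of_lt (lt_top_iff_ne_top.2 hW)
  obtain ⟨l, hl, hlW⟩ := Submodule.exists_le_ker_of_notMem hw
  refine ⟨W' ⊔ Submodule.span K {w}, l, ?_, w,
    Submodule.mem_sup_right (Submodule.mem_span_singleton_self w), hl⟩
  rw [sup_inf_assoc_of_le _ hlW, left_eq_sup]
  rintro _ ⟨hv, hvl⟩
  obtain ⟨c, rfl⟩ := Submodule.mem_span_singleton.1 hv
  have : c = 0 := by simpa [hl] using hvl
  simp [this]

namespace IsHyperplaneOf

variable {W W' : Submodule K (σ → K)} {l : Module.Dual K (σ → K)}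

omit [Fintype σ] [DecidableEq σ] in
lemma exists_apply_eq_one (h : IsHyperplaneOf W' W l) : ∃ w ∈ W, l w = 1 := by
  obtain ⟨w, hw, hlw⟩ := h.exists_apply_ne_zero
  exact ⟨(l w)⁻¹ • w, W.smul_mem _ hw, by simp [hlw]⟩

omit [DecidableEq σ] in
lemma finrank (h : IsHyperplaneOf W' W l) :
    Module.finrank K W = Module.finrank K W' + 1 := by
  obtain ⟨w, hw, hlw⟩ := h.exists_apply_ne_zero
  have hsurj : Function.Surjective (l ∘ₗ W.subtype) :=
    LinearMap.surjective fun h0 => hlw (LinearMap.congr_fun h0 ⟨w, hw⟩)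
  have h1 := LinearMap.finrank_range_add_finrank_ker (l ∘ₗ W.subtype)
  rw [LinearMap.range_eq_top.2 hsurj, finrank_top, Module.finrank_self, LinearMap.ker_comp,
    ← Submodule.finrank_map_subtype_eq, Submodule.map_comap_subtype, ← h.eq_inf] at h1
  omega

lemma linForm_notMem (h : IsHyperplaneOf W' W l) : linForm l ∉ linIdeal W := by
  obtain ⟨w, hw, hlw⟩ := h.exists_apply_ne_zero
  intro hl
  have := mem_linIdeal.1 hl w hw
  rw [eval_linForm] at this
  exact hlw this

variable [Infinite K]

lemma linIdeal_eq (h : IsHyperplaneOf W' W l) :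
    linIdeal W' = linIdeal W ⊔ Ideal.span {linForm l} := by
  obtain ⟨w, hw, hlw⟩ := h.exists_apply_eq_one
  apply le_antisymm
  · intro q hq
    -- As `l w = 1`, `v ↦ v - l(v) w` projects `W` onto `W'`, and it changes each coordinate by a
    -- multiple of `l`.
    have h1 : q - pullback (LinearMap.id - l.smulRight w) q ∈ Ideal.span {linForm l} := by
      refine sub_aeval_mem (fun i => Ideal.mem_span_singleton'.2 ⟨C (w i), ?_⟩) q
      refine MvPolynomial.funext fun v => ?_
      simp [mul_comm]
    have h2 : pullback (LinearMap.id - l.smulRight w) q ∈ linIdeal W := by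
      refine mem_linIdeal.2 fun v hv => ?_
      rw [eval_pullback]
      refine mem_linIdeal.1 hq _ ?_
      rw [h.eq_inf]
      exact ⟨W.sub_mem hv (W.smul_mem _ hw), by simp [hlw]⟩
    rw [← sub_add_cancel q (pullback (LinearMap.id - l.smulRight w) q)]
    exact add_mem (Ideal.mem_sup_right h1) (Ideal.mem_sup_left h2)
  · refine sup_le (linIdeal_anti (h.eq_inf ▸ inf_le_left)) ?_
    rw [Ideal.span_singleton_le_iff_mem, mem_linIdeal]
    intro v hv
    rw [h.eq_inf] at hv
    simpa using hv.2

end IsHyperplaneOf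

/-- Composing `q` with a projection that fixes `W` and kills `W'` gives a polynomial equal to `q` on
`W` and to `q(0) = 0` on `W'`. -/
lemma linIdeal_bot_le_sup {W W' : Submodule K (σ → K)} (h : Disjoint W W') :
    linIdeal ⊥ ≤ linIdeal W ⊔ linIdeal W' := by
  obtain ⟨U, hWU, hU⟩ := h.exists_isCompl
  intro q hq
  rw [← sub_add_cancel q (pullback (U.projection W' hU) q)]
  refine add_mem (Ideal.mem_sup_left (mem_linIdeal.2 fun v hv => ?_))
    (Ideal.mem_sup_right (mem_linIdeal.2 fun v hv => ?_))
  · rw [map_sub, eval_pullback, Submodule.projection_apply_of_mem_left hU (hWU hv), sub_self]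
  · rw [eval_pullback, Submodule.projection_apply_of_mem_right hU hv]
    exact mem_linIdeal.1 hq 0 (Submodule.zero_mem _)

variable [Infinite K]

/-- It is the kernel of pullback along a projection onto `W`, a homomorphism into a domain. -/
instance linIdeal_isPrime (W : Submodule K (σ → K)) : (linIdeal W).IsPrime := by
  obtain ⟨W', hW'⟩ := W.exists_isCompl
  have : linIdeal W = RingHom.ker (pullback (W.projection W' hW')) := by
    ext q
    rw [mem_linIdeal, RingHom.mem_ker]
    constructor
    · intro h
      refine MvPolynomial.funext fun v => ?_
      rw [eval_pullback, map_zero]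
      exact h _ (by simp)
    · intro h v hv
      have := eval_pullback (W.projection W' hW') v q
      rw [h, map_zero] at this
      rw [this, Submodule.projection_apply_of_mem_left hW' hv]
  rw [this]
  exact RingHom.ker_isPrime _

omit [Fintype σ] [DecidableEq σ] in
lemma linIdeal_top : linIdeal (⊤ : Submodule K (σ → K)) = ⊥ := by
  rw [eq_bot_iff]
  intro q hq
  exact MvPolynomial.funext fun v => by simpa using mem_linIdeal.1 hq v trivial

/-- Induction on the codimension of `W` for the behaviour of `K[x] ⧸ linIdeal W`. -/
lemma linIdeal_codim_induction {motive : ℕ → Ideal (MvPolynomial σ K) → Prop}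
    (bot : motive 0 ⊥)
    (step : ∀ (c : ℕ) (I : Ideal (MvPolynomial σ K)) (l : Module.Dual K (σ → K)), I.IsPrime →
      linForm l ∉ I → motive c I → motive (c + 1) (I ⊔ Ideal.span {linForm l}))
    (c : ℕ) (W : Submodule K (σ → K)) (hW : Module.finrank K W + c = Fintype.card σ) :
    motive c (linIdeal W) := by
  induction c generalizing W with
  | zero =>
    have : W = ⊤ := Submodule.eq_top_of_finrank_eq (by simpa using hW)
    rwa [this, linIdeal_top]
  | succ c ih =>
    obtain ⟨U, l, h⟩ := exists_isHyperplaneOf_right (W' := W) (by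
      rintro rfl
      rw [finrank_top, Module.finrank_fintype_fun_eq_card] at hW
      omega)
    rw [h.linIdeal_eq]
    exact step c _ l inferInstance h.linForm_notMem (ih U (by have := h.finrank; omega))

lemma pdLT_linIdeal (c : ℕ) (W : Submodule K (σ → K))
    (hW : Module.finrank K W + c = Fintype.card σ) : PdLT (linIdeal W) (c + 1) :=
  linIdeal_codim_induction (motive := fun c I => PdLT I (c + 1)) pdLT_bot
    (fun _ I _ _ hl h => pdLT_sup_span_singleton I hl h) c W hW

lemma not_pdLT_linIdeal (c : ℕ) (W : Submodule K (σ → K))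
    (hW : Module.finrank K W + c = Fintype.card σ) : ¬ PdLT (linIdeal W) c :=
  not_pdLT_of_nontrivial_ext <|
    linIdeal_codim_induction (motive := fun c I => Nontrivial (Abelian.Ext
      (ModuleCat.of (MvPolynomial σ K) (MvPolynomial σ K ⧸ I)) (ModuleCat.of (MvPolynomial σ K)
        (MvPolynomial σ K ⧸ (linIdeal (⊥ : Submodule K (σ → K))))) c))
    (nontrivial_ext_zero bot_le linIdeal_bot_isMaximal.ne_top)
    (fun _ I l _ hl h => nontrivial_ext_sup_span_singleton I _ hl
      (idealOfVars_le_linIdeal_bot (linForm_mem_idealOfVars l)) h) c W hW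

lemma ringKrullDim_quotient_sup_span_singleton_add_one_le {A : Type*} [CommRing A] (I : Ideal A)
    [I.IsPrime] {a : A} (ha : a ∉ I) :
    ringKrullDim (A ⧸ (I ⊔ Ideal.span {a})) + 1 ≤ ringKrullDim (A ⧸ I) :=
  ringKrullDim_succ_le_of_surjective (Ideal.Quotient.factor le_sup_left)
    (Ideal.Quotient.factor_surjective _) (r := Ideal.Quotient.mk I a)
    (mem_nonZeroDivisors_of_ne_zero (by rwa [Ne, Ideal.Quotient.eq_zero_iff_mem]))
    (by
      rw [Ideal.Quotient.factor_mk, Ideal.Quotient.eq_zero_iff_mem]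
      exact Ideal.mem_sup_right (Ideal.mem_span_singleton_self a))

lemma ringKrullDim_linIdeal_add_le (c : ℕ) (W : Submodule K (σ → K))
    (hW : Module.finrank K W + c = Fintype.card σ) :
    ringKrullDim (MvPolynomial σ K ⧸ linIdeal W) + c ≤ Fintype.card σ :=
  linIdeal_codim_induction
    (motive := fun c I => ringKrullDim (MvPolynomial σ K ⧸ I) + c ≤ Fintype.card σ)
    (by
      rw [ringKrullDim_eq_of_ringEquiv (RingEquiv.quotientBot _),
        MvPolynomial.ringKrullDim_of_isNoetherianRing]
      simp)
    (fun c I l _ hl h => by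
      refine le_trans ?_ h
      rw [Nat.cast_add, Nat.cast_one, add_comm (c : WithBot ℕ∞) 1, ← add_assoc]
      gcongr
      exact ringKrullDim_quotient_sup_span_singleton_add_one_le I hl) c W hW

lemma le_ringKrullDim_linIdeal (d : ℕ) (W : Submodule K (σ → K)) (hW : Module.finrank K W = d) :
    d ≤ ringKrullDim (MvPolynomial σ K ⧸ linIdeal W) := by
  induction d generalizing W with
  | zero => exact ringKrullDim_nonneg_of_nontrivial
  | succ d ih =>
    obtain ⟨U, l, h⟩ := exists_isHyperplaneOf_left (W := W) (by
      rintro rfl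
      simp at hW)
    refine le_trans ?_ (ringKrullDim_quotient_sup_span_singleton_add_one_le _ h.linForm_notMem)
    rw [← h.linIdeal_eq, Nat.cast_add, Nat.cast_one]
    gcongr
    exact ih U (by have := h.finrank; omega)

/-- Each hyperplane cut lowers the dimension by at least one: cutting from the whole space down to
`W` bounds it above, cutting from `W` down to the origin bounds it below. -/
lemma ringKrullDim_linIdeal (W : Submodule K (σ → K)) :
    ringKrullDim (MvPolynomial σ K ⧸ linIdeal W) = Module.finrank K W := by
  refine le_antisymm ?_ (le_ringKrullDim_linIdeal _ W rfl)
  obtain ⟨c, hc⟩ : ∃ c, Module.finrank K W + c = Fintype.card σ :=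
    ⟨_, Nat.add_sub_of_le (by simpa using W.finrank_le)⟩
  have := ringKrullDim_linIdeal_add_le c W hc
  rw [← hc, Nat.cast_add] at this
  exact ENat.WithBot.add_le_add_natCast_right_iff.1 this

lemma two_le_depthIn_linIdeal (W : Submodule K (σ → K)) (hW : Module.finrank K W = 2) :
    2 ≤ depthIn ((idealOfVars σ K).map (Ideal.Quotient.mk (linIdeal W))) := by
  obtain ⟨U, l, h⟩ := exists_isHyperplaneOf_left (W := W) (by rintro rfl; simp at hW)
  obtain ⟨U', l', h'⟩ := exists_isHyperplaneOf_left (W := U) (by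
    rintro rfl
    have := h.finrank
    rw [finrank_bot] at this
    omega)
  -- Dividing by `l` gives the coordinate ring of `U`, a domain in which `l'` is nonzero.
  have hdvd : ∀ q, Ideal.Quotient.mk (linIdeal W) (linForm l) ∣ Ideal.Quotient.mk _ q ↔
      q ∈ linIdeal U := by
    intro q
    rw [h.linIdeal_eq, ← Ideal.mem_span_singleton, ← Set.image_singleton, ← Ideal.map_span,
      ← Ideal.mem_comap, Ideal.comap_map_of_surjective' _ Ideal.Quotient.mk_surjective,
      Ideal.mk_ker, sup_comm]
  refine length_le_depthIn (rs := [Ideal.Quotient.mk _ (linForm l),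
    Ideal.Quotient.mk _ (linForm l')]) (map_idealOfVars_ne_top (linIdeal_anti bot_le)) ?_ ?_
  · refine isWeaklyRegular_pair_iff.2 ⟨fun y hy => ?_, fun y hy => ?_⟩
    · refine (mul_eq_zero.1 hy).resolve_left ?_
      rw [Ideal.Quotient.eq_zero_iff_mem]
      exact h.linForm_notMem
    · obtain ⟨y, rfl⟩ := Ideal.Quotient.mk_surjective y
      rw [← map_mul, hdvd] at hy
      exact (hdvd y).2 ((Ideal.IsPrime.mem_or_mem inferInstance hy).resolve_left h'.linForm_notMem)
  · simpa only [List.mem_cons, List.not_mem_nil, or_false, forall_eq_or_imp, forall_eq] using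
      ⟨mk_linForm_mem_map _ l, mk_linForm_mem_map _ l'⟩

end LinearForms

end LinesInProjectiveSpace

namespace LinesInProjectiveSpace

open CategoryTheory RingTheory.Sequence MvPolynomial

lemma eval_smul_of_isHomogeneous {σ K : Type*} [CommSemiring K] {f : MvPolynomial σ K} {d : ℕ}
    (hf : f.IsHomogeneous d) (t : K) (v : σ → K) : eval (t • v) f = t ^ d * eval v f := by
  rw [eval_eq, eval_eq, Finset.mul_sum]
  refine Finset.sum_congr rfl fun e he => ?_
  have : ∑ i ∈ e.support, e i = d := by
    simpa [Finsupp.weight_apply, Finsupp.sum] using hf (mem_support_iff.1 he)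
  simp only [Pi.smul_apply, smul_eq_mul, mul_pow, Finset.prod_mul_distrib]
  rw [Finset.prod_pow_eq_pow_sum, this]
  ring

/-! ### The defining ideal as an intersection of linear primes -/

section DefiningIdeal

variable {n : ℕ}

/-- The affine cone over a linear subspace. -/
noncomputable abbrev cone (L : LinSubspace n) : Submodule ℂ (Fin (n + 1) → ℂ) :=
  Projectivization.Subspace.submodule L

lemma mk_mem_pointSet_iff {M : Finset (LinSubspace n)} {v : Fin (n + 1) → ℂ} (hv : v ≠ 0) :
    Projectivization.mk ℂ v hv ∈ pointSet M ↔ ∃ L ∈ M, v ∈ cone L := by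
  simp only [pointSet, Set.mem_iUnion, SetLike.mem_coe, exists_prop]
  exact exists_congr fun L => and_congr_right fun _ =>
    (Projectivization.Subspace.mem_submodule_iff L hv).symm

/-- The homogeneous components of a polynomial vanishing on a linear subspace vanish on it. -/
lemma homogeneousComponent_mem_linIdeal {σ K : Type} [Field K] [Infinite K]
    {W : Submodule K (σ → K)} {f : MvPolynomial σ K} (hf : f ∈ linIdeal W) (d : ℕ) :
    homogeneousComponent d f ∈ linIdeal W := by
  rw [mem_linIdeal]
  intro v hv
  -- `q(t) = f(t v)` vanishes for every `t` because `W` is closed under scaling; its coefficients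
  -- are the wanted values.
  let q : Polynomial K := ∑ i ∈ Finset.range (f.totalDegree + 1),
    Polynomial.monomial i (eval v (homogeneousComponent i f))
  have hq : q = 0 := by
    refine Polynomial.funext fun t => ?_
    have h := mem_linIdeal.1 hf (t • v) (W.smul_mem t hv)
    rw [← sum_homogeneousComponent f, map_sum] at h
    rw [Polynomial.eval_finsetSum, Polynomial.eval_zero, ← h]
    refine Finset.sum_congr rfl fun i _ => ?_
    rw [Polynomial.eval_monomial, eval_smul_of_isHomogeneous (homogeneousComponent_isHomogeneous i f),
      mul_comm]
  by_cases hd : d < f.totalDegree + 1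
  · have := congrArg (fun q => Polynomial.coeff q d) hq
    simpa [q, Polynomial.finsetSum_coeff, Polynomial.coeff_monomial, hd] using this
  · rw [homogeneousComponent_eq_zero _ _ (by omega), map_zero]

lemma definingIdeal_pointSet {M : Finset (LinSubspace n)}
    (hM : ∀ L ∈ M, cone L ≠ ⊥) :
    definingIdeal (pointSet M) = M.inf fun L => linIdeal (cone L) := by
  apply le_antisymm
  · refine Ideal.span_le.2 ?_
    rintro f ⟨⟨d, hd⟩, hf⟩
    rw [SetLike.mem_coe, Submodule.mem_finsetInf]
    intro L hL
    have hv : ∀ v ∈ cone L, v ≠ 0 → eval v f = 0 := fun v hv hv0 =>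
      hf v hv0 ((mk_mem_pointSet_iff hv0).2 ⟨L, hL, hv⟩)
    refine mem_linIdeal.2 fun v hvL => ?_
    by_cases hv0 : v = 0
    -- The origin is not a projective point. A nonzero `w` in the cone is needed to exclude nonzero
    -- constants, the case `d = 0`.
    · obtain ⟨w, hw, hw0⟩ := (cone L).exists_mem_ne_zero_of_ne_bot (hM L hL)
      have h := eval_smul_of_isHomogeneous hd (0 : ℂ) w
      rw [hv w hw hw0, mul_zero, zero_smul] at h
      rw [hv0, h]
    · exact hv v hvL hv0
  · intro f hf
    rw [← sum_homogeneousComponent f]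
    refine Ideal.sum_mem _ fun d _ => Ideal.subset_span
      ⟨⟨d, homogeneousComponent_isHomogeneous d f⟩, fun v hv hvM => ?_⟩
    obtain ⟨L, hL, hvL⟩ := (mk_mem_pointSet_iff hv).1 hvM
    exact mem_linIdeal.1 (homogeneousComponent_mem_linIdeal
      ((Submodule.mem_finsetInf.1 hf) L hL) d) v hvL

lemma disjoint_cone (hn : 3 ≤ n) {M : Finset (LinSubspace n)} (hlines : ∀ L ∈ M, IsLine L)
    (hM : InGeneralLinearPosition M) {L L' : LinSubspace n} (hL : L ∈ M) (hL' : L' ∈ M)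
    (hne : L ≠ L') : Disjoint (cone L) (cone L') := by
  classical
  have h := hM {L, L'} (by simp [Finset.insert_subset_iff, hL, hL']) (by simp)
  have hspan : Projectivization.Subspace.span (pointSet {L, L'}) = L ⊔ L' := by
    simp [pointSet, Projectivization.Subspace.span_union]
  -- Since `n ≥ 3`, the minimum is 3; the sum of the cones thus has dimension `4 = 2 + 2`, leaving
  -- no intersection.
  rw [hspan, IsPr, map_sup, Finset.card_pair hne, min_eq_left (by omega)] at h
  have h1 : Module.finrank ℂ (cone L) = 2 := hlines L hL
  have h2 : Module.finrank ℂ (cone L') = 2 := hlines L' hL'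
  have h3 := Submodule.finrank_sup_add_finrank_inf_eq (cone L) (cone L')
  rw [disjoint_iff, ← Submodule.finrank_eq_zero (R := ℂ)]
  change Module.finrank ℂ ↥(cone L ⊔ cone L') = _ at h
  omega

end DefiningIdeal

/-! ### Transfer to the coordinate ring -/

section Invariants

variable {n : ℕ} {M : Finset (LinSubspace n)} {I : Ideal (S n)}

lemma depth_eq (hI : definingIdeal (pointSet M) = I) :
    depth M = depthIn ((idealOfVars (Fin (n + 1)) ℂ).map (Ideal.Quotient.mk I)) := by
  subst hI
  rfl

lemma pdim_eq (hI : definingIdeal (pointSet M) = I) {d : ℕ} (h : PdLT I (d + 1))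
    (h' : ¬ PdLT I d) : pdim M = d := by
  subst hI
  exact le_antisymm ((projectiveDimension_le_iff _ _).2 h) ((projectiveDimension_ge_iff _ _).2 h')

lemma one_le_depthIn_finset_inf {K σ ι : Type} [Field K] [Infinite K] [Fintype σ] [DecidableEq σ]
    {s : Finset ι} (hs : s.Nonempty) {W : ι → Submodule K (σ → K)} (hW : ∀ i ∈ s, W i ≠ ⊥) :
    1 ≤ depthIn ((idealOfVars σ K).map (Ideal.Quotient.mk (s.inf fun i => linIdeal (W i)))) := by
  have hvars : ∀ i ∈ s, ¬ idealOfVars σ K ≤ linIdeal (W i) := by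
    intro i hi hle
    obtain ⟨U, l, h⟩ := exists_isHyperplaneOf_left (hW i hi)
    exact h.linForm_notMem (hle (linForm_mem_idealOfVars l))
  obtain ⟨a, ha, hai⟩ := exists_mem_forall_notMem (p := fun i => linIdeal (W i))
    (fun i _ => linIdeal_isPrime (W i)) hvars
  obtain ⟨i, hi⟩ := hs
  refine length_le_depthIn (rs := [Ideal.Quotient.mk _ a])
    (map_idealOfVars_ne_top ((Finset.inf_le hi).trans (linIdeal_anti bot_le))) ?_ ?_
  · rw [isWeaklyRegular_singleton_iff, isSMulRegular_iff_right_eq_zero_of_smul]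
    intro y hy
    obtain ⟨y, rfl⟩ := Ideal.Quotient.mk_surjective y
    rw [smul_eq_mul, ← map_mul, Ideal.Quotient.eq_zero_iff_mem,
      mul_mem_finset_inf_iff (fun i _ => linIdeal_isPrime (W i)) hai] at hy
    rwa [Ideal.Quotient.eq_zero_iff_mem]
  · intro r hr
    rw [List.mem_singleton.1 hr]
    exact Ideal.mem_map_of_mem _ ha

end Invariants

end LinesInProjectiveSpace

/-! ### The main theorem -/

open LinesInProjectiveSpace in
theorem proposition3p1 (n : ℕ) (hn : 3 ≤ n)
    (M : Finset (LinesInProjectiveSpace.LinSubspace n)) (hne : M.Nonempty)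
    (hlines : ∀ L ∈ M, LinesInProjectiveSpace.IsLine L)
    (hM : LinesInProjectiveSpace.InGeneralLinearPosition M) :
    (M.card = 1 →
      LinesInProjectiveSpace.pdim M = ((n - 1 : ℕ) : WithBot ℕ∞) ∧
      LinesInProjectiveSpace.depth M = 2 ∧
      ringKrullDim (LinesInProjectiveSpace.CoordRing M) = 2) ∧
    (2 ≤ M.card →
      LinesInProjectiveSpace.pdim M = (n : WithBot ℕ∞) ∧
      LinesInProjectiveSpace.depth M = 1 ∧
      ringKrullDim (LinesInProjectiveSpace.CoordRing M) = 2) ∧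
    (LinesInProjectiveSpace.IsCohenMacaulay M ↔ M.card = 1) := by
  have hrank : ∀ L ∈ M, Module.finrank ℂ (cone L) = 2 := hlines
  have hbot : ∀ L ∈ M, cone L ≠ ⊥ := fun L hL h => by
    have := hrank L hL
    rw [h, finrank_bot] at this
    omega
  have hI := definingIdeal_pointSet hbot
  have hdim : ringKrullDim (CoordRing M) = 2 := by
    rw [ringKrullDim_eq_of_ringEquiv (Ideal.quotEquivOfEq hI)]
    refine ringKrullDim_quotient_finset_inf hne fun L hL => ?_
    rw [ringKrullDim_linIdeal, hrank L hL]
    rfl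
  have hcodim : ∀ L ∈ M, Module.finrank ℂ (cone L) + (n - 1) = Fintype.card (Fin (n + 1)) := by
    intro L hL
    rw [hrank L hL, Fintype.card_fin]
    omega
  have hone : M.card = 1 → pdim M = ((n - 1 : ℕ) : WithBot ℕ∞) ∧ depth M = 2 ∧
      ringKrullDim (CoordRing M) = 2 := by
    intro h1
    obtain ⟨L, rfl⟩ := Finset.card_eq_one.1 h1
    have hL : L ∈ ({L} : Finset (LinSubspace n)) := Finset.mem_singleton_self L
    rw [Finset.inf_singleton] at hI
    refine ⟨pdim_eq hI (pdLT_linIdeal _ _ (hcodim L hL)) (not_pdLT_linIdeal _ _ (hcodim L hL)),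
      ?_, hdim⟩
    rw [depth_eq hI]
    refine le_antisymm ?_ (two_le_depthIn_linIdeal (cone L) (hrank L hL))
    have := depthIn_le_ringKrullDim
      ((MvPolynomial.idealOfVars (Fin (n + 1)) ℂ).map
        (Ideal.Quotient.mk (linIdeal (cone L))))
    rw [ringKrullDim_linIdeal, hrank L hL] at this
    exact WithBot.coe_le_coe.1 this
  have htwo : 2 ≤ M.card → pdim M = (n : WithBot ℕ∞) ∧ depth M = 1 ∧
      ringKrullDim (CoordRing M) = 2 := by
    intro h2
    have hm := linIdeal_bot_isMaximal (K := ℂ) (σ := Fin (n + 1))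
    have hmcodim : Module.finrank ℂ (⊥ : Submodule ℂ (Fin (n + 1) → ℂ)) + (n + 1) =
        Fintype.card (Fin (n + 1)) := by simp
    have hmd := pdLT_linIdeal (n + 1) _ hmcodim
    -- The true value is `n - 1`; the bound `n` suffices, as the sum term has projective dimension
    -- `n + 1`.
    have hpd : ∀ L ∈ M, PdLT (linIdeal (cone L)) (n + 1) := fun L hL =>
      hasProjectiveDimensionLT_of_le (by omega) (pdLT_linIdeal _ _ (hcodim L hL))
    have hsup : ∀ L ∈ M, ∀ L' ∈ M, L ≠ L' →
        linIdeal ⊥ ≤ linIdeal (cone L) ⊔ linIdeal (cone L') := fun L hL L' hL' hne =>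
      linIdeal_bot_le_sup (disjoint_cone hn hlines hM hL hL' hne)
    refine ⟨pdim_eq hI (pdLT_finset_inf hm hmd hne hpd hsup) (not_pdLT_finset_inf hm hmd
      (not_pdLT_linIdeal (n + 1) _ hmcodim) h2 (fun L _ => linIdeal_anti bot_le) hpd hsup), ?_,
      hdim⟩
    rw [depth_eq hI]
    refine le_antisymm (depthIn_quotient_finset_inf_le_one hm h2 (fun L _ => inferInstance)
      (fun L hL => (linIdeal_anti bot_le).lt_of_ne fun h => ?_) hsup idealOfVars_le_linIdeal_bot)
      (one_le_depthIn_finset_inf hne hbot)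
    obtain ⟨U, l, hl⟩ := exists_isHyperplaneOf_left (hbot L hL)
    exact hl.linForm_notMem (h ▸ idealOfVars_le_linIdeal_bot (linForm_mem_idealOfVars l))
  refine ⟨hone, htwo, fun h => ?_, fun h => ?_⟩
  · by_contra h1
    have hpos := hne.card_pos
    rw [IsCohenMacaulay, (htwo (by omega)).2.1, hdim] at h
    exact absurd (WithBot.coe_injective h : (1 : ℕ∞) = 2) (by decide)
  · rw [IsCohenMacaulay, (hone h).2.1, hdim]
    rfl
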